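/- For a real $n\times n$ matrix $A$ and a set $\alpha\subseteq\{1,\dots,n\}$ let $A[\alpha]$ denote the principal minor of $A$ with rows and columns indexed by $\alpha$, with $A[\emptyset]:=1$. Call $A$ an $M$-matrix if all its off-diagonal entries are nonpositive and $A[\alpha]\ge 0$ for all $\alpha\subseteq\{1,\dots,n\}$ (so singular $M$-matrices are included), and call $A$ an inverse $M$-matrix if $A$ is invertible and $A^{-1}$ is an $M$-matrix. For nonnegative integers $m_1,m_2,k$ put $$S_{m_1,m_2,k}(A):=\sum_{\substack{\alpha,\beta\subseteq\{1,\dots,n\}\\ \#\alpha=m_1,\ \#\beta=m_2,\ \#(\alpha\cap\beta)=k}}A[\alpha]\,A[\beta],$$ the sum being over ordered pairs $(\alpha,\beta)$. Theorem. Let $A$ be an $M$-matrix or an inverse $M$-matrix of order $n$, and let $m,k$ be nonnegative integers with $k<m<n$ and $2m-k\le n$. Then $S_{m,m,k}(I_n)>0$, $S_{m+1,m-1,k}(I_n)>0$, and $$\frac{S_{m,m,k}(A)}{S_{m,m,k}(I_n)}\ \ge\ \frac{S_{m+1,m-1,k}(A)}{S_{m+1,m-1,k}(I_n)},$$ where $I_n$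 is the identity matrix of order $n$. -/

import Mathlib

/-- The principal minor `A[α]`: the determinant of the submatrix of `A` whose rows and columns are
indexed by `α`. The empty minor is `1`. -/
noncomputable def principalMinor {n : ℕ} (A : Matrix (Fin n) (Fin n) ℝ) (α : Finset (Fin n)) : ℝ :=
  (A.submatrix (fun i : α => (i : Fin n)) (fun i : α => (i : Fin n))).det

/-- A (possibly singular) `M`-matrix: all principal minors are nonnegative and all off-diagonal
entries are nonpositive. -/
def IsMMatrix {n : ℕ} (A : Matrix (Fin n) (Fin n) ℝ) : Prop :=
  (∀ α : Finset (Fin n), 0 ≤ principalMinor A α) ∧ ∀ i j : Fin n, i ≠ j → A i j ≤ 0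

/-- An inverse `M`-matrix: an invertible matrix whose inverse is an `M`-matrix. -/
def IsInverseMMatrix {n : ℕ} (A : Matrix (Fin n) (Fin n) ℝ) : Prop :=
  IsUnit A.det ∧ IsMMatrix A⁻¹

/-- `S_{m₁,m₂,k}(A)`: the sum of `A[α] A[β]` over all ordered pairs `(α, β)` of index sets with
`#α = m₁`, `#β = m₂` and `#(α ∩ β) = k`. -/
noncomputable def minorSum {n : ℕ} (m₁ m₂ k : ℕ) (A : Matrix (Fin n) (Fin n) ℝ) : ℝ :=
  ∑ p : Finset (Fin n) × Finset (Fin n) with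
      p.1.card = m₁ ∧ p.2.card = m₂ ∧ (p.1 ∩ p.2).card = k,
    principalMinor A p.1 * principalMinor A p.2

/-! Group the pairs `(α, β)` by `γ = α ∩ β` and by the symmetric difference `T`, with `#T = 2(q +
1)` and `m = k + q + 1`. For the identity, each group contributes a binomial coefficient, and the
two normalising constants have ratio `(q + 1) : (q + 2)`. It therefore suffices to compare, within
each group, two coefficients of the polynomial with terms `A[γ ∪ σ] A[γ ∪ (T \ σ)] X ^ #σ`, where `σ
⊆ T`.

For an M-matrix, replacing `A` by `A + ε I` makes all principal minors positive, and a positive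
column scaling then makes all row sums positive. Pivoting on `γ` preserves this strict dominance and
reduces to `γ = ∅`. Each row of a dominant matrix is a nonnegative combination of the rows `e i` and
`e i - e k`. By multilinearity the polynomial is a nonnegative combination of those for the matrices
`funLaplacian φ`, where it can be computed: it is a product of factors `1 + X` and, for cycles of
length `c`, `(1 + X) ^ c - 1 - X ^ c`.

These factors are palindromic, with coefficients that increase up to the middle relative to the
binomial coefficients. That property (`IsBinomUnimodal`) survives nonnegative combinations and,
which is the main point, products. Inverse M-matrices reduce to M-matrices by Jacobi's identity and
complementation. -/

/-! ### Principal minors: masking, complements, direct sums, pivoting -/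

/-- The matrix that agrees with `A` on `α × α` and with the identity matrix elsewhere. -/
def maskMatrix {n : ℕ} (A : Matrix (Fin n) (Fin n) ℝ) (α : Finset (Fin n)) :
    Matrix (Fin n) (Fin n) ℝ :=
  Matrix.of fun i j => if i ∈ α ∧ j ∈ α then A i j else (1 : Matrix (Fin n) (Fin n) ℝ) i j

/-- Identity columns outside `α` make `M` block triangular. Working with full-size matrices avoids
changing index types. -/
theorem det_eq_principalMinor {n : ℕ} {M A : Matrix (Fin n) (Fin n) ℝ} {α : Finset (Fin n)}
    (h₁ : ∀ i ∈ α, ∀ j ∈ α, M i j = A i j)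
    (h₂ : ∀ i, ∀ j ∉ α, M i j = (1 : Matrix (Fin n) (Fin n) ℝ) i j) :
    M.det = principalMinor A α := by
  rw [Matrix.twoBlockTriangular_det' M (· ∈ α)]
  · have e1 : M.toSquareBlockProp (· ∈ α)
        = A.submatrix (fun i : α => (i : Fin n)) (fun i : α => (i : Fin n)) := by
      ext i j
      exact h₁ i i.2 j j.2
    have e2 : M.toSquareBlockProp (fun i => ¬ i ∈ α) = 1 := by
      ext i j
      have := h₂ i j j.2
      simp only [Matrix.toSquareBlockProp_def, Matrix.of_apply, this, Matrix.one_apply,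
        Subtype.ext_iff]
    rw [e2, Matrix.det_one, mul_one]
    unfold principalMinor
    rw [← e1]
    congr!
  · intro i hi j hj
    rw [h₂ i j hj, Matrix.one_apply_ne]
    rintro rfl
    exact hj hi

theorem det_maskMatrix {n : ℕ} (A : Matrix (Fin n) (Fin n) ℝ) (α : Finset (Fin n)) :
    (maskMatrix A α).det = principalMinor A α := by
  apply det_eq_principalMinor
  · intro i hi j hj
    simp [maskMatrix, hi, hj]
  · intro i j hj
    simp [maskMatrix, hj]

theorem principalMinor_congr {n : ℕ} {A B : Matrix (Fin n) (Fin n) ℝ} {α : Finset (Fin n)}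
    (h : ∀ i ∈ α, ∀ j ∈ α, A i j = B i j) : principalMinor A α = principalMinor B α := by
  unfold principalMinor
  congr 1
  ext i j
  exact h i i.2 j j.2

theorem principalMinor_empty {n : ℕ} (A : Matrix (Fin n) (Fin n) ℝ) :
    principalMinor A ∅ = 1 := by
  simp [principalMinor]

theorem principalMinor_singleton {n : ℕ} (A : Matrix (Fin n) (Fin n) ℝ) (p : Fin n) :
    principalMinor A {p} = A p p := by
  have : Unique ({p} : Finset (Fin n)) := ⟨⟨⟨p, by simp⟩⟩,
    fun x => Subtype.ext (Finset.mem_singleton.mp x.2)⟩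
  unfold principalMinor
  rw [Matrix.det_unique, Matrix.submatrix_apply]
  have h := Finset.mem_singleton.mp (default : ({p} : Finset (Fin n))).2
  rw [h]

theorem principalMinor_one {n : ℕ} (α : Finset (Fin n)) :
    principalMinor (1 : Matrix (Fin n) (Fin n) ℝ) α = 1 := by
  rw [← det_eq_principalMinor (M := 1) (fun _ _ _ _ => rfl) (fun _ _ _ => rfl), Matrix.det_one]

theorem principalMinor_mul_diagonal {n : ℕ} (A : Matrix (Fin n) (Fin n) ℝ) (x : Fin n → ℝ)
    (α : Finset (Fin n)) :
    principalMinor (A * Matrix.diagonal x) α = (∏ i ∈ α, x i) * principalMinor A α := by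
  unfold principalMinor
  rw [← Finset.prod_coe_sort α x, ← Matrix.det_mul_row]
  congr 1
  ext i j
  simp [Matrix.mul_diagonal, mul_comm]

theorem continuous_principalMinor {n : ℕ} (α : Finset (Fin n)) :
    Continuous fun A : Matrix (Fin n) (Fin n) ℝ => principalMinor A α :=
  (continuous_id.matrix_submatrix _ _).matrix_det

/-- Jacobi's identity for complementary principal minors. -/
theorem principalMinor_eq_det_mul_inv {n : ℕ} {A : Matrix (Fin n) (Fin n) ℝ} (hA : IsUnit A.det)
    (α : Finset (Fin n)) :
    principalMinor A α = A.det * principalMinor A⁻¹ αᶜ := by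
  -- Mixing columns of `A⁻¹` with identity columns makes `A * X` consist of columns of `A` on `α`
  -- and identity columns elsewhere.
  set X : Matrix (Fin n) (Fin n) ℝ :=
    Matrix.of fun i j => if j ∈ α then (1 : Matrix (Fin n) (Fin n) ℝ) i j else A⁻¹ i j with hX
  have hdX : X.det = principalMinor A⁻¹ αᶜ := by
    apply det_eq_principalMinor
    · intro i _ j hj
      simp [hX, Finset.mem_compl.mp hj]
    · intro i j hj
      have hj : j ∈ α := by simpa using hj
      simp [hX, hj]
  have hAX : ∀ i j, (A * X) i j = if j ∈ α then A i j else (1 : Matrix (Fin n) (Fin n) ℝ) i j := by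
    intro i j
    split_ifs with hj
    · conv_rhs => rw [← mul_one A]
      simp only [Matrix.mul_apply, hX, Matrix.of_apply, hj, if_true]
    · rw [← Matrix.mul_nonsing_inv A hA]
      simp only [Matrix.mul_apply, hX, Matrix.of_apply, hj, if_false]
  rw [← hdX, ← Matrix.det_mul]
  symm
  apply det_eq_principalMinor
  · intro i _ j hj
    rw [hAX, if_pos hj]
  · intro i j hj
    rw [hAX, if_neg hj]

/-- The matrix that agrees with `A` on `s × s` and `t × t` and with the identity elsewhere. -/
def blockMask {n : ℕ} (A : Matrix (Fin n) (Fin n) ℝ) (s t : Finset (Fin n)) :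
    Matrix (Fin n) (Fin n) ℝ :=
  Matrix.of fun i j => if (i ∈ s ∧ j ∈ s) ∨ (i ∈ t ∧ j ∈ t) then A i j
    else (1 : Matrix (Fin n) (Fin n) ℝ) i j

theorem det_blockMask {n : ℕ} (A : Matrix (Fin n) (Fin n) ℝ) {s t : Finset (Fin n)}
    (hst : Disjoint s t) :
    (blockMask A s t).det = principalMinor A s * principalMinor A t := by
  rw [← det_maskMatrix, ← det_maskMatrix, ← Matrix.det_mul]
  congr 1
  ext i j
  by_cases hi : i ∈ s
  · have hit : i ∉ t := Finset.disjoint_left.mp hst hi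
    have : (maskMatrix A s * maskMatrix A t) i j
        = (maskMatrix A s * (1 : Matrix (Fin n) (Fin n) ℝ)) i j := by
      simp only [Matrix.mul_apply]
      refine Finset.sum_congr rfl fun k _ => ?_
      by_cases hk : k ∈ s
      · have hkt : k ∉ t := Finset.disjoint_left.mp hst hk
        simp [maskMatrix, hkt]
      · have hik : i ≠ k := fun h => hk (h ▸ hi)
        simp [maskMatrix, hk, Matrix.one_apply_ne hik]
    rw [this, mul_one]
    simp [blockMask, maskMatrix, hit]
  · have : (maskMatrix A s * maskMatrix A t) i j
        = ((1 : Matrix (Fin n) (Fin n) ℝ) * maskMatrix A t) i j := by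
      simp [Matrix.mul_apply, maskMatrix, hi]
    rw [this, one_mul]
    simp [blockMask, maskMatrix, hi]

theorem principalMinor_union {n : ℕ} {A : Matrix (Fin n) (Fin n) ℝ} {s t : Finset (Fin n)}
    (hst : Disjoint s t) (h₁ : ∀ i ∈ s, ∀ j ∈ t, A i j = 0) (h₂ : ∀ i ∈ t, ∀ j ∈ s, A i j = 0) :
    principalMinor A (s ∪ t) = principalMinor A s * principalMinor A t := by
  rw [← det_blockMask A hst]
  symm
  apply det_eq_principalMinor
  · intro i hi j hj
    rw [Finset.mem_union] at hi hj
    have hd : ∀ k ∈ s, k ∉ t := fun k => (Finset.disjoint_left.mp hst ·)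
    rcases hi with hi | hi <;> rcases hj with hj | hj
    · simp [blockMask, hi, hj]
    · have hij : i ≠ j := fun h => hd i hi (h ▸ hj)
      have hi' := hd i hi
      have hj' : j ∉ s := fun h => hd j h hj
      simp [blockMask, hi', hj', hij, h₁ i hi j hj]
    · have hij : i ≠ j := fun h => hd j hj (h ▸ hi)
      have hj' := hd j hj
      have hi' : i ∉ s := fun h => hd i h hi
      simp [blockMask, hi', hj', hij, h₂ i hi j hj]
    · simp [blockMask, hi, hj]
  · intro i j hj
    rw [Finset.mem_union, not_or] at hj
    simp [blockMask, hj.1, hj.2]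

/-- The Schur complement of the entry `A p p`, extended by a unit in position `(p, p)`. -/
noncomputable def pivot {n : ℕ} (A : Matrix (Fin n) (Fin n) ℝ) (p : Fin n) :
    Matrix (Fin n) (Fin n) ℝ :=
  Matrix.of fun i j => A i j - A i p * A p j / A p p + if i = p ∧ j = p then 1 else 0

theorem principalMinor_insert {n : ℕ} {A : Matrix (Fin n) (Fin n) ℝ} {p : Fin n}
    (hp : A p p ≠ 0) {s : Finset (Fin n)} (hs : p ∉ s) :
    principalMinor A (insert p s) = A p p * principalMinor (pivot A p) s := by
  -- Gaussian elimination read backwards: scale column `p` of `Z` by the pivot, then add multiples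
  -- of row `p` to recover `A` on `insert p s`.
  set Z : Matrix (Fin n) (Fin n) ℝ := Matrix.of fun i j =>
    if j ∈ s then (if i = p then A p j else pivot A p i j)
    else (1 : Matrix (Fin n) (Fin n) ℝ) i j with hZ
  have hdZ : Z.det = principalMinor (pivot A p) s := by
    apply det_eq_principalMinor
    · intro i hi j hj
      have : i ≠ p := fun h => hs (h ▸ hi)
      simp [hZ, hj, this]
    · intro i j hj
      simp [hZ, hj]
  set v : Fin n → ℝ := fun j => if j = p then A p p else 1 with hv
  set W : Matrix (Fin n) (Fin n) ℝ := Matrix.of fun i j => v j * Z i j with hW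
  have hdv : W.det = A p p * principalMinor (pivot A p) s := by
    rw [hW, Matrix.det_mul_row, hdZ]
    simp [hv]
  rw [← hdv]
  set c : Fin n → ℝ := fun i => if i = p then 0 else A i p / A p p with hc
  rw [← Matrix.det_eq_of_forall_row_eq_smul_add_const
    (A := Matrix.of fun i j => W i j + c i * W p j) c p (by simp [hc])
    (fun i j => rfl)]
  symm
  apply det_eq_principalMinor
  · intro i hi j hj
    rw [Finset.mem_insert] at hi hj
    by_cases hip : i = p <;> by_cases hjp : j = p
    · subst hip; subst hjp
      simp [hW, hZ, hv, hc, hs]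
    · have hj' := hj.resolve_left hjp
      subst hip
      simp [hW, hZ, hv, hc, hjp, hj']
    · subst hjp
      simp [hW, hZ, hv, hc, hip, hs]
      field_simp
    · have hj' := hj.resolve_left hjp
      simp [hW, hZ, hv, hc, hip, hjp, hj', pivot]
      ring
  · intro i j hj
    rw [Finset.mem_insert, not_or] at hj
    have : p ≠ j := fun h => hj.1 h.symm
    simp [hW, hZ, hv, hj.1, hj.2, this]

theorem principalMinor_insert_of_col_eq {n : ℕ} {A : Matrix (Fin n) (Fin n) ℝ} {p : Fin n}
    (hp : A p p = 1) {s : Finset (Fin n)} (hs : p ∉ s) (h : ∀ i ∈ s, A i p = 0) :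
    principalMinor A (insert p s) = principalMinor A s := by
  rw [principalMinor_insert (by simp [hp]) hs, hp, one_mul]
  apply principalMinor_congr
  intro i hi j _
  have : i ≠ p := fun e => hs (e ▸ hi)
  simp [pivot, h i hi, this]

/-! ### Strictly dominant matrices and diagonal scaling -/

/-- Off-diagonal entries are nonpositive and row sums are positive. -/
structure IsStrictDominant {n : ℕ} (A : Matrix (Fin n) (Fin n) ℝ) : Prop where
  nonpos : ∀ i j, i ≠ j → A i j ≤ 0
  row_sum_pos : ∀ i, 0 < ∑ j, A i j

theorem IsStrictDominant.diag_pos {n : ℕ} {A : Matrix (Fin n) (Fin n) ℝ}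
    (hA : IsStrictDominant A) (i : Fin n) : 0 < A i i := by
  have h := hA.row_sum_pos i
  rw [← Finset.add_sum_erase _ _ (Finset.mem_univ i)] at h
  have : ∑ j ∈ Finset.univ.erase i, A i j ≤ 0 :=
    Finset.sum_nonpos fun j hj => hA.nonpos i j (Finset.ne_of_mem_erase hj).symm
  linarith

theorem pivot_nonpos {n : ℕ} {A : Matrix (Fin n) (Fin n) ℝ} (hA : ∀ i j, i ≠ j → A i j ≤ 0)
    {p : Fin n} (hp : 0 < A p p) (i j : Fin n) (hij : i ≠ j) : pivot A p i j ≤ 0 := by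
  by_cases hi : i = p
  · subst hi
    simp [pivot, Ne.symm hij]
    field_simp
    simp
  by_cases hj : j = p
  · subst hj
    simp [pivot, hij]
    field_simp
    simp
  · have h1 := hA i j hij
    have h2 : 0 ≤ A i p * A p j / A p p :=
      div_nonneg (mul_nonneg_of_nonpos_of_nonpos (hA i p hi) (hA p j (Ne.symm hj))) hp.le
    simp [pivot, hi]
    linarith

theorem IsStrictDominant.pivot {n : ℕ} {A : Matrix (Fin n) (Fin n) ℝ}
    (hA : IsStrictDominant A) (p : Fin n) : IsStrictDominant (pivot A p) := by
  have hp := hA.diag_pos p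
  refine ⟨pivot_nonpos hA.nonpos hp, fun i => ?_⟩
  have hsum : ∑ j, _root_.pivot A p i j
      = ∑ j, A i j - A i p / A p p * ∑ j, A p j + if i = p then 1 else 0 := by
    simp only [_root_.pivot, Matrix.of_apply, Finset.sum_add_distrib, Finset.sum_sub_distrib,
      Finset.mul_sum]
    congr 2
    · exact Finset.sum_congr rfl fun j _ => by ring
    · by_cases hi : i = p <;> simp [hi]
  rw [hsum]
  by_cases hi : i = p
  · subst hi
    simp [hp.ne']
  · have h1 : A i p / A p p * ∑ j, A p j ≤ 0 :=
      mul_nonpos_of_nonpos_of_nonneg (div_nonpos_of_nonpos_of_nonneg (hA.nonpos i p hi) hp.le)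
        (hA.row_sum_pos p).le
    have := hA.row_sum_pos i
    simp only [hi, if_false]
    linarith

/-- Pivoting successively on the elements of `γ` keeps dominance; `c` is the product of the pivots
and does not depend on `σ`. -/
theorem IsStrictDominant.exists_schur {n : ℕ} {A : Matrix (Fin n) (Fin n) ℝ}
    (hA : IsStrictDominant A) (γ : Finset (Fin n)) :
    ∃ B : Matrix (Fin n) (Fin n) ℝ, ∃ c : ℝ, IsStrictDominant B ∧ 0 < c ∧
      ∀ σ, Disjoint γ σ → principalMinor A (γ ∪ σ) = c * principalMinor B σ := by
  induction γ using Finset.induction_on generalizing A with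
  | empty => exact ⟨A, 1, hA, one_pos, fun σ _ => by simp⟩
  | insert p γ hp ih =>
    obtain ⟨B, c, hB, hc, h⟩ := ih (hA.pivot p)
    refine ⟨B, A p p * c, hB, mul_pos (hA.diag_pos p) hc, fun σ hσ => ?_⟩
    rw [Finset.disjoint_insert_left] at hσ
    rw [Finset.insert_union, principalMinor_insert (hA.diag_pos p).ne' (by simp [hp, hσ.1]),
      h σ hσ.2, mul_assoc]

/-- Induction through the Schur complement, whose principal minors are quotients of those of `A` by
the pivot. The vector found supplies the column scaling. -/
theorem exists_pos_mulVec_pos {n : ℕ} {A : Matrix (Fin n) (Fin n) ℝ}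
    (hA : ∀ i j, i ≠ j → A i j ≤ 0) (s : Finset (Fin n))
    (hs : ∀ α ⊆ s, 0 < principalMinor A α) :
    ∃ x : Fin n → ℝ, (∀ i, 0 < x i) ∧ ∀ i ∈ s, 0 < ∑ j ∈ s, A i j * x j := by
  induction s using Finset.induction_on generalizing A with
  | empty => exact ⟨fun _ => 1, fun _ => one_pos, by simp⟩
  | insert p s hp ih =>
    have hpp : 0 < A p p := by
      rw [← principalMinor_singleton A p]
      exact hs _ (by simp)
    obtain ⟨y, hy, hB⟩ := ih (A := pivot A p) (pivot_nonpos hA hpp) (by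
      intro α hα
      have hpα : p ∉ α := fun h => hp (hα h)
      have := hs (insert p α) (Finset.insert_subset_insert p hα)
      rw [principalMinor_insert hpp.ne' hpα] at this
      exact pos_of_mul_pos_right this hpp.le)
    obtain ⟨ε, hε, hε0⟩ : ∃ ε : ℝ, (∀ i ∈ s, 0 < ∑ j ∈ s, pivot A p i j * y j + A i p * ε) ∧
        0 < ε := by
      have h1 : ∀ᶠ ε in nhdsWithin (0 : ℝ) (Set.Ioi 0),
          ∀ i ∈ s, 0 < ∑ j ∈ s, pivot A p i j * y j + A i p * ε := by
        rw [Filter.eventually_all_finset]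
        intro i hi
        apply eventually_nhdsWithin_of_eventually_nhds
        have hcont : Continuous fun ε : ℝ => ∑ j ∈ s, pivot A p i j * y j + A i p * ε := by
          fun_prop
        exact hcont.continuousAt.eventually_const_lt (by simpa using hB i hi)
      obtain ⟨ε, h, h'⟩ := (h1.and self_mem_nhdsWithin).exists
      exact ⟨ε, h, h'⟩
    -- With entry `t` at `p`, row `p` gives zero and the other rows reproduce the Schur complement
    -- applied to `y`. The extra `ε` makes row `p` positive and is small enough to keep the others
    -- positive.
    set t : ℝ := -(∑ j ∈ s, A p j * y j) / A p p with ht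
    have ht0 : 0 ≤ t := by
      refine div_nonneg (neg_nonneg.mpr (Finset.sum_nonpos fun j hj => ?_)) hpp.le
      exact mul_nonpos_of_nonpos_of_nonneg (hA p j (by rintro rfl; exact hp hj)) (hy j).le
    have hsum : ∀ i, ∑ j ∈ insert p s, A i j * Function.update y p (t + ε) j
        = A i p * (t + ε) + ∑ j ∈ s, A i j * y j := by
      intro i
      rw [Finset.sum_insert hp, Function.update_self]
      congr 1
      refine Finset.sum_congr rfl fun j hj => ?_
      rw [Function.update_of_ne (show j ≠ p by rintro rfl; exact hp hj)]
    refine ⟨Function.update y p (t + ε), fun i => ?_, fun i hi => ?_⟩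
    · by_cases hi : i = p
      · subst hi
        rw [Function.update_self]
        linarith
      · rw [Function.update_of_ne hi]
        exact hy i
    · rw [hsum]
      rw [Finset.mem_insert] at hi
      rcases hi with rfl | hi
      · have h2 : A i i * t = -∑ j ∈ s, A i j * y j := by
          rw [ht]
          field_simp
        have h3 := mul_pos hpp hε0
        linarith
      · have hip : i ≠ p := fun h => hp (h ▸ hi)
        have h4 : ∑ j ∈ s, pivot A p i j * y j = ∑ j ∈ s, A i j * y j + A i p * t := by
          have : ∀ j ∈ s, pivot A p i j * y j = A i j * y j - A i p / A p p * (A p j * y j) := by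
            intro j _
            simp only [pivot, Matrix.of_apply, hip, false_and, if_false]
            ring
          rw [Finset.sum_congr rfl this, Finset.sum_sub_distrib, ← Finset.mul_sum, ht]
          ring
        have := hε i hi
        rw [h4] at this
        linarith

theorem exists_isStrictDominant_mul_diagonal {n : ℕ} {A : Matrix (Fin n) (Fin n) ℝ}
    (hA : ∀ i j, i ≠ j → A i j ≤ 0) (hpos : ∀ α, 0 < principalMinor A α) :
    ∃ x : Fin n → ℝ, (∀ i, 0 < x i) ∧ IsStrictDominant (A * Matrix.diagonal x) := by
  obtain ⟨x, hx, h⟩ := exists_pos_mulVec_pos hA Finset.univ fun α _ => hpos α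
  refine ⟨x, hx, fun i j hij => ?_, fun i => ?_⟩
  · rw [Matrix.mul_diagonal]
    exact mul_nonpos_of_nonpos_of_nonneg (hA i j hij) (hx j).le
  · simpa only [Matrix.mul_diagonal] using h i (Finset.mem_univ i)

/-! ### Perturbation to positive principal minors -/

theorem principalMinor_add_single {n : ℕ} (A : Matrix (Fin n) (Fin n) ℝ) (ε : ℝ) {i : Fin n}
    {α : Finset (Fin n)} (hi : i ∈ α) :
    principalMinor (A + Matrix.single i i ε) α
      = principalMinor A α + ε * principalMinor A (α.erase i) := by
  have h0 : (Matrix.updateCol (maskMatrix A α) i (Pi.single i 1)).det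
      = principalMinor A (α.erase i) := by
    apply det_eq_principalMinor
    · intro k hk j hj
      rw [Finset.mem_erase] at hk hj
      rw [Matrix.updateCol_ne hj.1]
      simp [maskMatrix, hk.2, hj.2]
    · intro k j hj
      by_cases hji : j = i
      · subst hji
        simp [Matrix.one_apply, Pi.single_apply]
      · rw [Matrix.updateCol_ne hji]
        have : j ∉ α := fun h => hj (Finset.mem_erase.mpr ⟨hji, h⟩)
        simp [maskMatrix, this]
  have h1 : maskMatrix (A + Matrix.single i i ε) α = Matrix.updateCol (maskMatrix A α) i
      ((fun k => maskMatrix A α k i) + ε • Pi.single i 1) := by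
    ext k j
    by_cases hji : j = i
    · subst hji
      by_cases hk : k = j
      · subst hk
        simp [maskMatrix, hi]
      · simp [maskMatrix, Ne.symm hk, hk, Matrix.single_apply]
    · rw [Matrix.updateCol_ne hji]
      simp [maskMatrix, Matrix.single_apply, Ne.symm hji]
  rw [← det_maskMatrix, h1, Matrix.det_updateCol_add, Matrix.det_updateCol_smul, h0,
    ← det_maskMatrix A α]
  congr 2
  ext k j
  by_cases hji : j = i
  · subst hji; simp
  · rw [Matrix.updateCol_ne hji]

theorem principalMinor_add_smul_one_pos {n : ℕ} {A : Matrix (Fin n) (Fin n) ℝ}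
    (hA : ∀ α, 0 ≤ principalMinor A α) {ε : ℝ} (hε : 0 < ε) (α : Finset (Fin n)) :
    0 < principalMinor (A + ε • 1) α := by
  -- Add `ε` one diagonal entry at a time: all minors stay nonnegative, and those supported on the
  -- treated indices are already positive.
  have key : ∀ t : Finset (Fin n), ∀ α, 0 ≤ principalMinor (A + ∑ i ∈ t, Matrix.single i i ε) α ∧
      (α ⊆ t → 0 < principalMinor (A + ∑ i ∈ t, Matrix.single i i ε) α) := by
    intro t
    induction t using Finset.induction_on with
    | empty =>
      intro α
      refine ⟨by simpa using hA α, fun h => ?_⟩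
      rw [Finset.subset_empty.mp h, principalMinor_empty]
      exact one_pos
    | insert p t hp ih =>
      intro α
      rw [Finset.sum_insert hp, add_comm (Matrix.single p p ε), ← add_assoc]
      set B := A + ∑ i ∈ t, Matrix.single i i ε with hB
      by_cases hpα : p ∈ α
      · rw [principalMinor_add_single B ε hpα]
        have h1 := (ih α).1
        have h2 := (ih (α.erase p)).1
        refine ⟨by positivity, fun h => ?_⟩
        have h3 := (ih (α.erase p)).2 (Finset.subset_insert_iff.mp h)
        positivity
      · have : principalMinor (B + Matrix.single p p ε) α = principalMinor B α := by
          apply principalMinor_congr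
          intro i hi j _
          have : p ≠ i := fun h => hpα (h ▸ hi)
          simp [this]
        rw [this]
        exact ⟨(ih α).1, fun h => (ih α).2 ((Finset.subset_insert_iff_of_notMem hpα).mp h)⟩
  have h := (key Finset.univ α).2 (Finset.subset_univ α)
  rwa [show (∑ i, Matrix.single i i ε : Matrix (Fin n) (Fin n) ℝ) = ε • 1 by
    rw [Matrix.sum_single_eq_diagonal (fun _ => ε), Matrix.smul_one_eq_diagonal]] at h

/-! ### Binomially unimodal polynomials -/

open Polynomial in
/-- A palindromic polynomial of degree `n` with nonnegative coefficients `a i` for which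
`a i / n.choose i` is nondecreasing up to the middle. -/
structure IsBinomUnimodal (n : ℕ) (P : ℝ[X]) : Prop where
  nonneg : ∀ i, 0 ≤ P.coeff i
  coeff_eq_zero : ∀ i, n < i → P.coeff i = 0
  symm : ∀ i ≤ n, P.coeff (n - i) = P.coeff i
  mono : ∀ i, 2 * i + 2 ≤ n → ((n : ℝ) - i) * P.coeff i ≤ (i + 1) * P.coeff (i + 1)

namespace IsBinomUnimodal

open Polynomial

theorem zero (n : ℕ) : IsBinomUnimodal n 0 := by
  constructor <;> simp

theorem add {n : ℕ} {P Q : ℝ[X]} (hP : IsBinomUnimodal n P) (hQ : IsBinomUnimodal n Q) :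
    IsBinomUnimodal n (P + Q) where
  nonneg i := by rw [coeff_add]; exact add_nonneg (hP.nonneg i) (hQ.nonneg i)
  coeff_eq_zero i hi := by rw [coeff_add, hP.coeff_eq_zero i hi, hQ.coeff_eq_zero i hi, add_zero]
  symm i hi := by rw [coeff_add, coeff_add, hP.symm i hi, hQ.symm i hi]
  mono i hi := by
    have h1 := hP.mono i hi
    have h2 := hQ.mono i hi
    rw [coeff_add, coeff_add]
    linarith

theorem C_mul {n : ℕ} {P : ℝ[X]} (hP : IsBinomUnimodal n P) {c : ℝ} (hc : 0 ≤ c) :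
    IsBinomUnimodal n (C c * P) where
  nonneg i := by rw [coeff_C_mul]; exact mul_nonneg hc (hP.nonneg i)
  coeff_eq_zero i hi := by rw [coeff_C_mul, hP.coeff_eq_zero i hi, mul_zero]
  symm i hi := by rw [coeff_C_mul, coeff_C_mul, hP.symm i hi]
  mono i hi := by
    have h1 := mul_le_mul_of_nonneg_left (hP.mono i hi) hc
    rw [coeff_C_mul, coeff_C_mul]
    linarith

theorem sum {ι : Type*} {n : ℕ} (s : Finset ι) {P : ι → ℝ[X]}
    (hP : ∀ i ∈ s, IsBinomUnimodal n (P i)) : IsBinomUnimodal n (∑ i ∈ s, P i) :=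
  Finset.sum_induction P (IsBinomUnimodal n) (fun _ _ => add) (zero n) hP

theorem coeff_le_coeff {n : ℕ} {P : ℝ[X]} (hP : IsBinomUnimodal n P) {i j : ℕ} (hij : i ≤ j)
    (h : i + j ≤ n) : P.coeff i ≤ P.coeff j := by
  have step : ∀ i, 2 * i + 2 ≤ n → P.coeff i ≤ P.coeff (i + 1) := by
    intro i hi
    have h1 := hP.mono i hi
    have h2 := hP.nonneg i
    have h3 : (2 * i + 2 : ℝ) ≤ n := by exact_mod_cast hi
    have h4 : ((i : ℝ) + 1) * P.coeff i ≤ (n - i) * P.coeff i :=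
      mul_le_mul_of_nonneg_right (by linarith) h2
    exact le_of_mul_le_mul_left (h4.trans h1) (by positivity)
  have half : ∀ i j, i ≤ j → 2 * j ≤ n → P.coeff i ≤ P.coeff j := by
    intro i j hij
    induction j, hij using Nat.le_induction with
    | base => exact fun _ => le_rfl
    | succ j _ ih => exact fun hj => (ih (by omega)).trans (step j (by omega))
  by_cases hj : 2 * j ≤ n
  · exact half i j hij hj
  · rw [← hP.symm j (by omega)]
    exact half i (n - j) (by omega) (by omega)

/-- Pairing `i` with `N - i` turns the convolution into a sum of terms `U i * (Q (k - i) - Q (k - N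
+ i))` with `2 * i ≤ N`. Both factors are nonnegative, because `Q` is unimodal and `2 * k ≤ N + n`.
-/
theorem coeff_mul_nonneg {n N k : ℕ} {Q U : ℝ[X]} (hQ : IsBinomUnimodal n Q)
    (hU : ∀ i, N < i → U.coeff i = 0) (hanti : ∀ i ≤ N, U.coeff (N - i) = -U.coeff i)
    (hpos : ∀ i, 2 * i ≤ N → 0 ≤ U.coeff i) (hk : 2 * k ≤ N + n) : 0 ≤ (U * Q).coeff k := by
  -- Extension by zero guards against truncated subtraction in `k - i`.
  set q : ℕ → ℝ := fun i => if i ≤ k then Q.coeff (k - i) else 0 with hq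
  have hsum : (U * Q).coeff k = ∑ i ∈ Finset.range (N + 1), U.coeff i * q i := by
    rw [coeff_mul, Finset.Nat.sum_antidiagonal_eq_sum_range_succ
      (fun i j => U.coeff i * Q.coeff j)]
    have h1 : ∑ i ∈ Finset.range (k + 1), U.coeff i * Q.coeff (k - i)
        = ∑ i ∈ Finset.range (k + 1), U.coeff i * q i := by
      refine Finset.sum_congr rfl fun i hi => ?_
      rw [hq]
      simp only [if_pos (Nat.lt_succ_iff.mp (Finset.mem_range.mp hi))]
    have h2 : ∀ a b : ℕ, (∀ i, a ≤ i → U.coeff i * q i = 0) →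
        ∑ i ∈ Finset.range (a + b), U.coeff i * q i = ∑ i ∈ Finset.range a, U.coeff i * q i := by
      intro a b hab
      rw [Finset.sum_range_add, Finset.sum_eq_zero (s := Finset.range b), add_zero]
      exact fun i _ => hab _ (by omega)
    rw [h1, ← h2 (k + 1) (N + 1), add_comm, h2 (N + 1) (k + 1)]
    · intro i hi
      rw [hU i (by omega), zero_mul]
    · intro i hi
      rw [hq]
      simp only [if_neg (show ¬ i ≤ k by omega), mul_zero]
  have hq_le : ∀ i j, i ≤ j → i + j = N → q j ≤ q i := by
    intro i j hij hN
    simp only [hq]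
    by_cases hj : j ≤ k
    · rw [if_pos hj, if_pos (by omega)]
      exact hQ.coeff_le_coeff (by omega) (by omega)
    · rw [if_neg hj]
      split_ifs
      · exact hQ.nonneg _
      · exact le_rfl
  have hrefl : ∑ i ∈ Finset.range (N + 1), U.coeff i * q i
      = ∑ i ∈ Finset.range (N + 1), -(U.coeff i * q (N - i)) := by
    rw [← Finset.sum_range_reflect]
    refine Finset.sum_congr rfl fun i hi => ?_
    rw [show N + 1 - 1 - i = N - i by omega,
      hanti i (Nat.lt_succ_iff.mp (Finset.mem_range.mp hi))]
    ring
  have h2 : 0 ≤ ∑ i ∈ Finset.range (N + 1), (U.coeff i * q i + -(U.coeff i * q (N - i))) := by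
    refine Finset.sum_nonneg fun i hi => ?_
    have hi : i ≤ N := Nat.lt_succ_iff.mp (Finset.mem_range.mp hi)
    by_cases h : 2 * i ≤ N
    · have h1 := mul_le_mul_of_nonneg_left (hq_le i (N - i) (by omega) (by omega)) (hpos i h)
      linarith
    · have h1 := mul_le_mul_of_nonneg_left (hq_le (N - i) i (by omega) (by omega))
        (hpos (N - i) (by omega))
      rw [hanti i hi] at h1
      linarith
  rw [Finset.sum_add_distrib, ← hrefl, ← hsum] at h2
  linarith

/-- This operator encodes `mono` as nonnegativity of coefficients; it annihilates `(1 + X) ^ n`. -/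
theorem coeff_one_add_X_mul_derivative (n : ℕ) (P : ℝ[X]) (i : ℕ) :
    ((1 + X) * derivative P - (n : ℝ[X]) * P).coeff i
      = (i + 1) * P.coeff (i + 1) - ((n : ℝ) - i) * P.coeff i := by
  rw [add_mul, one_mul, coeff_sub, coeff_add, coeff_derivative, ← C_eq_natCast, coeff_C_mul]
  cases i with
  | zero => simp
  | succ i => rw [coeff_X_mul, coeff_derivative]; push_cast; ring

theorem derivative_mul_coeff_nonneg {n m i : ℕ} {P Q : ℝ[X]} (hP : IsBinomUnimodal n P)
    (hQ : IsBinomUnimodal m Q) (hi : 2 * i + 2 ≤ n + m) :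
    0 ≤ (((1 + X) * derivative P - (n : ℝ[X]) * P) * Q).coeff i := by
  rcases n with _ | n
  · have hz : (1 + X) * derivative P - ((0 : ℕ) : ℝ[X]) * P = 0 := by
      ext j
      rw [coeff_one_add_X_mul_derivative, hP.coeff_eq_zero (j + 1) (by omega)]
      rcases j with _ | j
      · simp
      · simp [hP.coeff_eq_zero (j + 1) (by omega)]
    rw [hz, zero_mul, coeff_zero]
  -- For `P` of formal degree `n + 1` the top coefficient cancels, leaving an antipalindromic
  -- polynomial of formal degree `n`.
  · refine hQ.coeff_mul_nonneg (N := n) ?_ ?_ ?_ (by omega)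
    · intro j hj
      rw [coeff_one_add_X_mul_derivative, hP.coeff_eq_zero (j + 1) (by omega)]
      rcases Nat.lt_or_ge (n + 1) j with h | h
      · rw [hP.coeff_eq_zero j h]; ring
      · obtain rfl : j = n + 1 := by omega
        push_cast; ring
    · intro j hj
      rw [coeff_one_add_X_mul_derivative, coeff_one_add_X_mul_derivative]
      have h1 := hP.symm j (by omega)
      have h2 := hP.symm (j + 1) (by omega)
      rw [show n + 1 - j = n - j + 1 by omega] at h1
      rw [show n + 1 - (j + 1) = n - j by omega] at h2
      rw [h1, h2]
      push_cast [Nat.cast_sub hj]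
      ring
    · intro j hj
      rw [coeff_one_add_X_mul_derivative]
      rcases Nat.lt_or_ge n (2 * j + 1) with h | h
      · obtain rfl : n = 2 * j := by omega
        have h1 := hP.symm j (by omega)
        rw [show 2 * j + 1 - j = j + 1 by omega] at h1
        rw [h1]
        push_cast
        apply le_of_eq
        ring
      · have := hP.mono j (by omega)
        linarith

/-- The operator `(1 + X) * derivative P - n * P` obeys a Leibniz rule with degrees adding, so
`mono` for `P * Q` splits into two instances of `derivative_mul_coeff_nonneg`. -/
theorem mul {n m : ℕ} {P Q : ℝ[X]} (hP : IsBinomUnimodal n P) (hQ : IsBinomUnimodal m Q) :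
    IsBinomUnimodal (n + m) (P * Q) where
  nonneg i := by
    rw [coeff_mul]
    exact Finset.sum_nonneg fun p _ => mul_nonneg (hP.nonneg _) (hQ.nonneg _)
  coeff_eq_zero i hi := by
    rw [coeff_mul]
    refine Finset.sum_eq_zero fun p hp => ?_
    rw [Finset.HasAntidiagonal.mem_antidiagonal] at hp
    rcases Nat.lt_or_ge n p.1 with h | h
    · rw [hP.coeff_eq_zero _ h, zero_mul]
    · rw [hQ.coeff_eq_zero p.2 (by omega), mul_zero]
  symm := by
    have hrefl : ∀ {k : ℕ} {R : ℝ[X]}, IsBinomUnimodal k R → R.reflect k = R := by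
      intro k R hR
      ext i
      rw [coeff_reflect]
      rcases Nat.lt_or_ge k i with h | h
      · rw [revAt_eq_self_of_lt h]
      · rw [revAt_le h, hR.symm i h]
    have hdeg : ∀ {k : ℕ} {R : ℝ[X]}, IsBinomUnimodal k R → R.natDegree ≤ k := fun hR =>
      natDegree_le_iff_coeff_eq_zero.mpr hR.coeff_eq_zero
    intro i hi
    have h := reflect_mul P Q (hdeg hP) (hdeg hQ)
    rw [hrefl hP, hrefl hQ] at h
    rw [← revAt_le hi, ← coeff_reflect, h]
  mono i hi := by
    have h1 := hP.derivative_mul_coeff_nonneg hQ hi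
    have h2 := hQ.derivative_mul_coeff_nonneg hP (i := i) (by omega)
    have h3 : (1 + X) * derivative (P * Q) - ((n + m : ℕ) : ℝ[X]) * (P * Q)
        = ((1 + X) * derivative P - (n : ℝ[X]) * P) * Q
          + ((1 + X) * derivative Q - (m : ℝ[X]) * Q) * P := by
      rw [derivative_mul]
      push_cast
      ring
    have h4 := coeff_one_add_X_mul_derivative (n + m) (P * Q) i
    rw [h3, coeff_add] at h4
    linarith

theorem one : IsBinomUnimodal 0 (1 : ℝ[X]) where
  nonneg i := by rw [coeff_one]; split_ifs <;> norm_num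
  coeff_eq_zero i hi := by rw [coeff_one, if_neg (by omega)]
  symm i hi := by rw [show 0 - i = i by omega]
  mono i hi := by omega

theorem one_add_X : IsBinomUnimodal 1 (1 + X : ℝ[X]) where
  nonneg i := by
    rw [coeff_add, coeff_one, coeff_X]
    split_ifs <;> norm_num
  coeff_eq_zero i hi := by
    rw [coeff_add, coeff_one, coeff_X, if_neg (by omega), if_neg (by omega), add_zero]
  symm i hi := by
    interval_cases i <;> simp [coeff_one, coeff_X]
  mono i hi := by omega

/-- Binomial coefficients give equality in `mono`; deleting the two end terms can only help. -/
theorem one_add_X_pow_sub {c : ℕ} (hc : 0 < c) :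
    IsBinomUnimodal c ((1 + X) ^ c - 1 - X ^ c : ℝ[X]) := by
  have hco : ∀ i, ((1 + X) ^ c - 1 - X ^ c : ℝ[X]).coeff i
      = (c.choose i : ℝ) - (if i = 0 then 1 else 0) - (if i = c then 1 else 0) := by
    intro i
    rw [coeff_sub, coeff_sub, coeff_one_add_X_pow, coeff_one, coeff_X_pow]
  constructor
  · intro i
    rw [hco]
    by_cases h0 : i = 0
    · subst h0; simp [hc.ne]
    · by_cases h1 : i = c
      · subst h1; simp [h0]
      · simp [h0, h1]
  · intro i hi
    rw [hco, Nat.choose_eq_zero_of_lt hi, if_neg (by omega), if_neg (by omega)]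
    simp
  · intro i hi
    rw [hco, hco, Nat.choose_symm hi]
    simp only [show (c - i = 0) = (i = c) from propext (by omega),
      show (c - i = c) = (i = 0) from propext (by omega)]
    ring
  · intro i hi
    rw [hco, hco, if_neg (show ¬ i + 1 = 0 by omega), if_neg (show ¬ i + 1 = c by omega),
      if_neg (show ¬ i = c by omega)]
    have h1 : (c.choose (i + 1) : ℝ) * (i + 1) = c.choose i * (c - i) := by
      rw [← Nat.cast_sub (show i ≤ c by omega)]
      exact_mod_cast Nat.choose_succ_right_eq c i
    have h2 : (0 : ℝ) ≤ (c - i) * (if i = 0 then 1 else 0) := by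
      have : (i : ℝ) ≤ c := by exact_mod_cast (show i ≤ c by omega)
      refine mul_nonneg (by linarith) ?_
      split_ifs <;> norm_num
    linarith

end IsBinomUnimodal

/-! ### The generating polynomial and its factorisations -/

open Polynomial in
/-- The generating polynomial of the products of complementary principal minors inside `T`. -/
noncomputable def minorPairPoly {n : ℕ} (A : Matrix (Fin n) (Fin n) ℝ) (T : Finset (Fin n)) :
    ℝ[X] :=
  ∑ σ ∈ T.powerset, C (principalMinor A σ * principalMinor A (T \ σ)) * X ^ σ.card

open Polynomial in
theorem coeff_minorPairPoly {n : ℕ} (A : Matrix (Fin n) (Fin n) ℝ) (T : Finset (Fin n)) (k : ℕ) :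
    (minorPairPoly A T).coeff k
      = ∑ σ ∈ T.powersetCard k, principalMinor A σ * principalMinor A (T \ σ) := by
  rw [minorPairPoly, finsetSum_coeff, Finset.powersetCard_eq_filter, Finset.sum_filter]
  refine Finset.sum_congr rfl fun σ _ => ?_
  rw [coeff_C_mul_X_pow]
  simp only [eq_comm]

theorem sum_powerset_union {ι M : Type*} [DecidableEq ι] [AddCommMonoid M] {s t : Finset ι}
    (h : Disjoint s t) (f : Finset ι → M) :
    ∑ σ ∈ (s ∪ t).powerset, f σ = ∑ σ ∈ s.powerset, ∑ τ ∈ t.powerset, f (σ ∪ τ) := by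
  rw [← Finset.sum_product']
  symm
  have hd : ∀ k ∈ s, k ∉ t := fun k => (Finset.disjoint_left.mp h ·)
  refine Finset.sum_nbij' (fun p => p.1 ∪ p.2) (fun ρ => (ρ ∩ s, ρ ∩ t)) ?_ ?_ ?_ ?_ ?_
  · rintro ⟨σ, τ⟩ hp
    simp only [Finset.mem_product, Finset.mem_powerset] at hp ⊢
    exact Finset.union_subset_union hp.1 hp.2
  · intro ρ _
    simp
  · rintro ⟨σ, τ⟩ hp
    simp only [Finset.mem_product, Finset.mem_powerset] at hp
    simp only [Prod.mk.injEq]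
    constructor
    · ext x
      have := @hp.1 x
      have := @hp.2 x
      have := hd x
      simp only [Finset.mem_inter, Finset.mem_union]
      tauto
    · ext x
      have := @hp.1 x
      have := @hp.2 x
      have := hd x
      simp only [Finset.mem_inter, Finset.mem_union]
      tauto
  · intro ρ hρ
    rw [Finset.mem_powerset] at hρ
    rw [← Finset.inter_union_distrib_left, Finset.inter_eq_left.mpr hρ]
  · intro p _
    rfl

theorem minorPairPoly_union {n : ℕ} {A : Matrix (Fin n) (Fin n) ℝ} {s t : Finset (Fin n)}
    (hst : Disjoint s t) (h₁ : ∀ i ∈ s, ∀ j ∈ t, A i j = 0) (h₂ : ∀ i ∈ t, ∀ j ∈ s, A i j = 0) :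
    minorPairPoly A (s ∪ t) = minorPairPoly A s * minorPairPoly A t := by
  have hunion : ∀ σ ⊆ s, ∀ τ ⊆ t,
      principalMinor A (σ ∪ τ) = principalMinor A σ * principalMinor A τ := fun σ hσ τ hτ =>
    principalMinor_union (Finset.disjoint_of_subset_left hσ (Finset.disjoint_of_subset_right hτ hst))
      (fun i hi j hj => h₁ i (hσ hi) j (hτ hj)) (fun i hi j hj => h₂ i (hτ hi) j (hσ hj))
  have hd : ∀ k ∈ s, k ∉ t := fun k => (Finset.disjoint_left.mp hst ·)
  rw [minorPairPoly, sum_powerset_union hst, minorPairPoly, minorPairPoly, Finset.sum_mul_sum]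
  refine Finset.sum_congr rfl fun σ hσ => Finset.sum_congr rfl fun τ hτ => ?_
  rw [Finset.mem_powerset] at hσ hτ
  have hdiff : (s ∪ t) \ (σ ∪ τ) = (s \ σ) ∪ (t \ τ) := by
    ext x
    have := @hσ x
    have := @hτ x
    have := hd x
    simp only [Finset.mem_sdiff, Finset.mem_union]
    tauto
  rw [hdiff, hunion σ hσ τ hτ, hunion _ Finset.sdiff_subset _ Finset.sdiff_subset,
    Finset.card_union_of_disjoint
      (Finset.disjoint_of_subset_left hσ (Finset.disjoint_of_subset_right hτ hst)), pow_add]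
  simp only [map_mul]
  ring

-- Column `p` is trivial on `T`, so `p` may join either side of the splitting without changing the
-- minors.
open Polynomial in
theorem minorPairPoly_insert {n : ℕ} {A : Matrix (Fin n) (Fin n) ℝ} {p : Fin n}
    {T : Finset (Fin n)} (hpT : p ∉ T) (hp : A p p = 1) (h : ∀ i ∈ T, A i p = 0) :
    minorPairPoly A (insert p T) = (1 + X) * minorPairPoly A T := by
  have hins : ∀ σ ⊆ T, principalMinor A (insert p σ) = principalMinor A σ := fun σ hσ =>
    principalMinor_insert_of_col_eq hp (fun hh => hpT (hσ hh)) fun i hi => h i (hσ hi)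
  have h1 : ∑ σ ∈ T.powerset, C (principalMinor A σ * principalMinor A (insert p T \ σ)) * X ^ σ.card
      = minorPairPoly A T := by
    refine Finset.sum_congr rfl fun σ hσ => ?_
    rw [Finset.mem_powerset] at hσ
    rw [Finset.insert_sdiff_of_notMem T fun hh => hpT (hσ hh), hins _ Finset.sdiff_subset]
  have h2 : ∑ σ ∈ T.powerset, C (principalMinor A (insert p σ) *
      principalMinor A (insert p T \ insert p σ)) * X ^ (insert p σ).card
      = X * minorPairPoly A T := by
    rw [minorPairPoly, Finset.mul_sum]
    refine Finset.sum_congr rfl fun σ hσ => ?_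
    rw [Finset.mem_powerset] at hσ
    have hpσ : p ∉ σ := fun hh => hpT (hσ hh)
    have hdiff : insert p T \ insert p σ = T \ σ := by
      ext x
      simp only [Finset.mem_sdiff, Finset.mem_insert, not_or]
      constructor
      · rintro ⟨h1 | h1, h2, h3⟩
        · exact absurd h1 h2
        · exact ⟨h1, h3⟩
      · rintro ⟨h1, h2⟩
        exact ⟨Or.inr h1, fun hx => hpT (hx ▸ h1), h2⟩
    rw [hdiff, hins σ hσ, Finset.card_insert_of_notMem hpσ, pow_succ']
    exact mul_left_comm _ _ _
  rw [minorPairPoly, Finset.sum_powerset_insert hpT, h1, h2, add_mul, one_mul]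

/-! ### Laplacians of functional graphs -/

/-- The matrix whose `i`-th row is `e i - e (φ i)`, or `e i` if `i` is a fixed point of `φ`. -/
def funLaplacian {n : ℕ} (φ : Fin n → Fin n) : Matrix (Fin n) (Fin n) ℝ :=
  Matrix.of fun i j => (1 : Matrix (Fin n) (Fin n) ℝ) i j - if φ i ≠ i ∧ j = φ i then 1 else 0

/-- Each element of `C` is the image under `φ` of another element of `C`. -/
def IsSelfCovered {n : ℕ} (φ : Fin n → Fin n) (C : Finset (Fin n)) : Prop :=
  ∀ i ∈ C, ∃ j ∈ C, j ≠ i ∧ φ j = i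

theorem funLaplacian_self {n : ℕ} (φ : Fin n → Fin n) (i : Fin n) : funLaplacian φ i i = 1 := by
  simp only [funLaplacian, Matrix.of_apply, Matrix.one_apply_eq]
  rw [if_neg]
  · simp
  · rintro ⟨h, h'⟩
    exact h h'.symm

theorem funLaplacian_eq_zero {n : ℕ} {φ : Fin n → Fin n} {i j : Fin n} (hij : i ≠ j)
    (h : φ i ≠ j) : funLaplacian φ i j = 0 := by
  simp [funLaplacian, hij, Ne.symm h]

/-- An index with no other preimage in `s` has a trivial column and can be removed; without
self-covered subsets this never stops early. -/
theorem principalMinor_funLaplacian_eq_one {n : ℕ} {φ : Fin n → Fin n} (s : Finset (Fin n))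
    (hs : ∀ C ⊆ s, C.Nonempty → ¬ IsSelfCovered φ C) : principalMinor (funLaplacian φ) s = 1 := by
  induction s using Finset.strongInduction with
  | H s ih =>
    rcases s.eq_empty_or_nonempty with rfl | hne
    · exact principalMinor_empty _
    · have h := hs s subset_rfl hne
      simp only [IsSelfCovered, not_forall, not_exists, not_and] at h
      obtain ⟨i, hi, h⟩ := h
      rw [← Finset.insert_erase hi, principalMinor_insert_of_col_eq (funLaplacian_self φ i)
        (Finset.notMem_erase i s)]
      · exact ih _ (Finset.erase_ssubset hi) fun C hC =>
          hs C (hC.trans (Finset.erase_subset i s))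
      · intro j hj
        rw [Finset.mem_erase] at hj
        exact funLaplacian_eq_zero hj.1 (h j hj.2 hj.1)

namespace IsSelfCovered

variable {n : ℕ} {φ : Fin n → Fin n} {C : Finset (Fin n)}

theorem image_eq (h : IsSelfCovered φ C) : C.image φ = C := by
  symm
  apply Finset.eq_of_subset_of_card_le _ Finset.card_image_le
  intro i hi
  obtain ⟨j, hj, _, hji⟩ := h i hi
  exact Finset.mem_image.mpr ⟨j, hj, hji⟩

theorem map_mem (h : IsSelfCovered φ C) {i : Fin n} (hi : i ∈ C) : φ i ∈ C := by
  have := Finset.mem_image_of_mem φ hi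
  rwa [h.image_eq] at this

theorem injOn (h : IsSelfCovered φ C) : Set.InjOn φ C :=
  Finset.card_image_iff.mp (by rw [h.image_eq])

theorem map_ne (h : IsSelfCovered φ C) {i : Fin n} (hi : i ∈ C) : φ i ≠ i := by
  obtain ⟨j, hj, hne, hji⟩ := h i hi
  exact fun hh => hne (h.injOn hj hi (hji.trans hh.symm))

theorem sdiff {T : Finset (Fin n)} (hT : IsSelfCovered φ T) (hC : IsSelfCovered φ C) :
    IsSelfCovered φ (T \ C) := by
  intro i hi
  rw [Finset.mem_sdiff] at hi
  obtain ⟨j, hj, hne, hji⟩ := hT i hi.1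
  exact ⟨j, Finset.mem_sdiff.mpr ⟨hj, fun hjC => hi.2 (hji ▸ hC.map_mem hjC)⟩, hne, hji⟩

/-- `φ` permutes `C` without fixed points, so every row of the submatrix sums to zero. -/
theorem principalMinor_funLaplacian_eq_zero (h : IsSelfCovered φ C) (hne : C.Nonempty) :
    principalMinor (funLaplacian φ) C = 0 := by
  unfold principalMinor
  obtain ⟨c, hc⟩ := hne
  apply Matrix.exists_mulVec_eq_zero_iff.mp
  refine ⟨fun _ => 1, fun hh => one_ne_zero (congrFun hh ⟨c, hc⟩), ?_⟩
  ext i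
  simp only [Matrix.mulVec, dotProduct, Matrix.submatrix_apply, mul_one, Pi.zero_apply]
  rw [Finset.sum_coe_sort C fun j => funLaplacian φ i j]
  simp only [funLaplacian, Matrix.of_apply, Finset.sum_sub_distrib, Matrix.one_apply, ne_eq,
    h.map_ne i.2, not_false_eq_true, true_and, Finset.sum_ite_eq, Finset.sum_ite_eq', i.2,
    h.map_mem i.2, if_true, sub_self]

-- A minimal self-covered set is a cycle: its minor is `0` and all proper minors are `1`, so only `σ
-- = ∅` and `σ = C` drop out of the binomial expansion.
open Polynomial in
theorem minorPairPoly_eq (h : IsSelfCovered φ C) (hne : C.Nonempty)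
    (hmin : ∀ D ⊂ C, D.Nonempty → ¬ IsSelfCovered φ D) :
    minorPairPoly (funLaplacian φ) C = (1 + X) ^ C.card - 1 - X ^ C.card := by
  have h0 := h.principalMinor_funLaplacian_eq_zero hne
  have h1 : ∀ s ⊂ C, principalMinor (funLaplacian φ) s = 1 := fun s hs =>
    principalMinor_funLaplacian_eq_one s fun D hD => hmin D (lt_of_le_of_lt hD hs)
  have hpow : ((1 + X) ^ C.card : ℝ[X]) = ∑ σ ∈ C.powerset, X ^ σ.card := by
    rw [add_comm, ← Finset.sum_pow_mul_eq_add_pow]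
    simp
  have hone : (1 : ℝ[X]) = ∑ σ ∈ C.powerset, if σ = ∅ then 1 else 0 := by
    rw [Finset.sum_ite_eq', if_pos (Finset.empty_mem_powerset C)]
  have htop : (X ^ C.card : ℝ[X]) = ∑ σ ∈ C.powerset, if σ = C then X ^ C.card else 0 := by
    rw [Finset.sum_ite_eq', if_pos (Finset.mem_powerset_self C)]
  rw [hpow, htop]
  nth_rw 1 [hone]
  rw [← Finset.sum_sub_distrib, ← Finset.sum_sub_distrib]
  refine Finset.sum_congr rfl fun σ hσ => ?_
  rw [Finset.mem_powerset] at hσ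
  by_cases hσ0 : σ = ∅
  · subst hσ0
    simp [h0, hne.ne_empty.symm]
  · by_cases hσC : σ = C
    · subst hσC
      simp [h0, hσ0]
    · have hs1 : σ ⊂ C := lt_of_le_of_ne hσ hσC
      have hs2 : C \ σ ⊂ C :=
        Finset.sdiff_ssubset hσ (Finset.nonempty_iff_ne_empty.mpr hσ0)
      simp [h1 _ hs1, h1 _ hs2, hσ0, hσC]

end IsSelfCovered

theorem isBinomUnimodal_minorPairPoly_funLaplacian {n : ℕ} (φ : Fin n → Fin n)
    (T : Finset (Fin n)) :
    IsBinomUnimodal T.card (minorPairPoly (funLaplacian φ) T) := by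
  induction T using Finset.strongInduction with
  | H T ih =>
    rcases T.eq_empty_or_nonempty with rfl | hne
    · have : minorPairPoly (funLaplacian φ) ∅ = 1 := by
        simp [minorPairPoly, principalMinor_empty]
      rw [this]
      exact IsBinomUnimodal.one
    -- Either `φ` permutes `T`, and a cycle splits off as a direct summand, or some index has a
    -- trivial column and contributes `1 + X`.
    by_cases hT : IsSelfCovered φ T
    · obtain ⟨C, ⟨hCT, hC, hCne⟩, hmin⟩ : ∃ C, (C ⊆ T ∧ IsSelfCovered φ C ∧ C.Nonempty) ∧
          ∀ D ⊂ C, ¬ (D ⊆ T ∧ IsSelfCovered φ D ∧ D.Nonempty) := by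
        obtain ⟨C, hC⟩ := Set.Finite.exists_minimal
          (Set.toFinite {C : Finset (Fin n) | C ⊆ T ∧ IsSelfCovered φ C ∧ C.Nonempty})
          ⟨T, subset_rfl, hT, hne⟩
        exact ⟨C, hC.prop, fun D hD hD' => hC.not_prop_of_lt hD hD'⟩
      have hcross₁ : ∀ i ∈ C, ∀ j ∈ T \ C, funLaplacian φ i j = 0 := by
        intro i hi j hj
        rw [Finset.mem_sdiff] at hj
        refine funLaplacian_eq_zero ?_ ?_
        · rintro rfl; exact hj.2 hi
        · rintro rfl; exact hj.2 (hC.map_mem hi)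
      have hcross₂ : ∀ i ∈ T \ C, ∀ j ∈ C, funLaplacian φ i j = 0 := by
        intro i hi j hj
        have h1 := (hT.sdiff hC).map_mem hi
        rw [Finset.mem_sdiff] at hi h1
        refine funLaplacian_eq_zero ?_ ?_
        · rintro rfl; exact hi.2 hj
        · rintro rfl; exact h1.2 hj
      have h := (IsBinomUnimodal.one_add_X_pow_sub hCne.card_pos).mul
        (ih (T \ C) (Finset.sdiff_ssubset hCT hCne))
      rw [← hC.minorPairPoly_eq hCne fun D hD hDne hD' => hmin D hD ⟨hD.1.trans hCT, hD', hDne⟩,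
        ← minorPairPoly_union Finset.disjoint_sdiff hcross₁ hcross₂, Finset.union_sdiff_of_subset hCT,
        add_comm, Finset.card_sdiff_add_card_eq_card hCT] at h
      exact h
    · simp only [IsSelfCovered, not_forall, not_exists, not_and] at hT
      obtain ⟨i, hi, h⟩ := hT
      have h1 := IsBinomUnimodal.one_add_X.mul (ih _ (Finset.erase_ssubset hi))
      rw [← minorPairPoly_insert (Finset.notMem_erase i T) (funLaplacian_self φ i),
        Finset.insert_erase hi, add_comm, Finset.card_erase_add_one hi] at h1
      · exact h1
      · intro j hj
        rw [Finset.mem_erase] at hj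
        exact funLaplacian_eq_zero hj.1 (h j hj.2 hj.1)

/-! ### Multilinear expansion over maps -/

/-- The coefficients of row `i` of `A` in terms of the rows of the matrices `funLaplacian φ`; rows
outside `T` are replaced by rows of the identity matrix. -/
def rowWeight {n : ℕ} (A : Matrix (Fin n) (Fin n) ℝ) (T : Finset (Fin n)) (i k : Fin n) : ℝ :=
  if i ∈ T then (if k = i then ∑ j, A i j else -A i k) else if k = i then 1 else 0

theorem IsStrictDominant.rowWeight_nonneg {n : ℕ} {A : Matrix (Fin n) (Fin n) ℝ}
    (hA : IsStrictDominant A) (T : Finset (Fin n)) (i k : Fin n) : 0 ≤ rowWeight A T i k := by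
  unfold rowWeight
  split_ifs with h1 h2 h3
  · exact (hA.row_sum_pos i).le
  · exact neg_nonneg.mpr (hA.nonpos i k (Ne.symm h2))
  · exact zero_le_one
  · exact le_rfl

theorem sum_rowWeight {n : ℕ} (A : Matrix (Fin n) (Fin n) ℝ) (T : Finset (Fin n)) (i : Fin n) :
    ∑ k, rowWeight A T i k = if i ∈ T then A i i else 1 := by
  by_cases hi : i ∈ T
  · simp only [rowWeight, hi, if_true]
    rw [← Finset.add_sum_erase _ _ (Finset.mem_univ i), if_pos rfl,
      ← Finset.add_sum_erase (a := i) Finset.univ (A i) (Finset.mem_univ i), add_assoc,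
      ← Finset.sum_add_distrib, Finset.sum_eq_zero, add_zero]
    intro k hk
    rw [if_neg (Finset.ne_of_mem_erase hk), add_neg_cancel]
  · simp [rowWeight, hi]

/-- Row `i` of `funLaplacian φ` depends only on `φ i`, so constant maps suffice. The weights depend
on `T` alone, hence one expansion serves all splittings of `T`. -/
theorem blockMask_row_eq_sum {n : ℕ} (A : Matrix (Fin n) (Fin n) ℝ) {s t T : Finset (Fin n)}
    (hT : s ∪ t = T) (i : Fin n) :
    blockMask A s t i = ∑ k, rowWeight A T i k • blockMask (funLaplacian fun _ => k) s t i := by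
  ext j
  simp only [Finset.sum_apply, Pi.smul_apply, smul_eq_mul, blockMask, Matrix.of_apply]
  have hTi : i ∈ T ↔ i ∈ s ∨ i ∈ t := by rw [← hT, Finset.mem_union]
  split_ifs with h
  · have hi : i ∈ T := hTi.mpr (h.imp And.left And.left)
    by_cases hij : i = j
    · subst hij
      have : ∀ k, funLaplacian (fun _ => k) i i = 1 := fun k => funLaplacian_self _ i
      simp only [this, mul_one, sum_rowWeight, if_pos hi]
    · rw [Finset.sum_eq_single j]
      · simp [funLaplacian, rowWeight, hi, hij, Ne.symm hij]
      · intro k _ hk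
        rw [funLaplacian_eq_zero hij hk, mul_zero]
      · simp
  · rw [← Finset.sum_mul, sum_rowWeight]
    by_cases hi : i ∈ T
    · have hij : i ≠ j := by
        rintro rfl
        have := hTi.mp hi
        tauto
      rw [Matrix.one_apply_ne hij, mul_zero]
    · rw [if_neg hi, one_mul]

theorem principalMinor_mul_eq_sum {n : ℕ} (A : Matrix (Fin n) (Fin n) ℝ) {s t T : Finset (Fin n)}
    (hst : Disjoint s t) (hT : s ∪ t = T) :
    principalMinor A s * principalMinor A t = ∑ φ : Fin n → Fin n, (∏ i, rowWeight A T i (φ i)) *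
      (principalMinor (funLaplacian φ) s * principalMinor (funLaplacian φ) t) := by
  rw [← det_blockMask A hst]
  have h1 : (blockMask A s t).det = Matrix.detRowAlternating (R := ℝ)
      fun i => ∑ k, rowWeight A T i k • blockMask (funLaplacian fun _ => k) s t i := by
    rw [← funext (blockMask_row_eq_sum A hT)]
    rfl
  rw [h1, ← AlternatingMap.coe_multilinearMap, MultilinearMap.map_sum]
  refine Finset.sum_congr rfl fun φ _ => ?_
  rw [MultilinearMap.map_smul_univ, ← det_blockMask _ hst, smul_eq_mul]
  rfl

theorem IsStrictDominant.isBinomUnimodal_minorPairPoly {n : ℕ} {A : Matrix (Fin n) (Fin n) ℝ}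
    (hA : IsStrictDominant A) (T : Finset (Fin n)) :
    IsBinomUnimodal T.card (minorPairPoly A T) := by
  have h : minorPairPoly A T = ∑ φ : Fin n → Fin n,
      Polynomial.C (∏ i, rowWeight A T i (φ i)) * minorPairPoly (funLaplacian φ) T := by
    simp only [minorPairPoly, Finset.mul_sum]
    rw [Finset.sum_comm]
    refine Finset.sum_congr rfl fun σ hσ => ?_
    rw [principalMinor_mul_eq_sum A Finset.disjoint_sdiff
      (Finset.union_sdiff_of_subset (Finset.mem_powerset.mp hσ)), map_sum, Finset.sum_mul]
    simp only [map_mul, mul_assoc]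
  rw [h]
  exact IsBinomUnimodal.sum _ fun φ _ =>
    (isBinomUnimodal_minorPairPoly_funLaplacian φ T).C_mul
      (Finset.prod_nonneg fun i _ => hA.rowWeight_nonneg T i (φ i))

/-! ### Minor sums of M-matrices -/

theorem minorSum_eq_sum {n : ℕ} (a b k : ℕ) (A : Matrix (Fin n) (Fin n) ℝ) :
    minorSum (k + a) (k + b) k A = ∑ γ ∈ Finset.powersetCard k Finset.univ,
      ∑ T ∈ Finset.powersetCard (a + b) γᶜ, ∑ σ ∈ Finset.powersetCard a T,
        principalMinor A (γ ∪ σ) * principalMinor A (γ ∪ T \ σ) := by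
  have hsig : ∀ γ : Finset (Fin n), ∑ T ∈ Finset.powersetCard (a + b) γᶜ,
      ∑ σ ∈ Finset.powersetCard a T,
        principalMinor A (γ ∪ σ) * principalMinor A (γ ∪ T \ σ)
      = ∑ q ∈ (Finset.powersetCard (a + b) γᶜ).sigma (fun T => Finset.powersetCard a T),
        principalMinor A (γ ∪ q.2) * principalMinor A (γ ∪ q.1 \ q.2) := fun γ =>
    Finset.sum_sigma' _ _ _
  rw [Finset.sum_congr rfl fun γ _ => hsig γ, Finset.sum_sigma', minorSum]
  refine Finset.sum_nbij'
    (i := fun p => (⟨p.1 ∩ p.2, ⟨(p.1 \ p.2) ∪ (p.2 \ p.1), p.1 \ p.2⟩⟩ :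
      (_ : Finset (Fin n)) × (_ : Finset (Fin n)) × Finset (Fin n)))
    (j := fun q => (q.1 ∪ q.2.2, q.1 ∪ q.2.1 \ q.2.2)) ?_ ?_ ?_ ?_ ?_
  · rintro ⟨α, β⟩ hp
    simp only [Finset.mem_filter, Finset.mem_univ, true_and] at hp
    obtain ⟨h1, h2, h3⟩ := hp
    have h4 := Finset.card_sdiff_add_card_inter α β
    have h5 := Finset.card_sdiff_add_card_inter β α
    rw [Finset.inter_comm] at h5
    simp only [Finset.mem_sigma, Finset.mem_powersetCard, Finset.subset_univ, true_and]
    refine ⟨h3, ⟨?_, ?_⟩, Finset.subset_union_left, by omega⟩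
    · intro x
      simp only [Finset.mem_union, Finset.mem_sdiff, Finset.mem_compl, Finset.mem_inter]
      tauto
    · rw [Finset.card_union_of_disjoint disjoint_sdiff_sdiff]
      omega
  · rintro ⟨γ, T, σ⟩ hq
    simp only [Finset.mem_sigma, Finset.mem_powersetCard, Finset.subset_univ, true_and] at hq
    obtain ⟨h1, ⟨h2, h3⟩, h4, h5⟩ := hq
    have hTγ : Disjoint γ T := (Finset.subset_compl_iff_disjoint_left).mp h2
    simp only [Finset.mem_filter, Finset.mem_univ, true_and]
    have hd := Finset.card_sdiff_add_card_eq_card h4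
    refine ⟨?_, ?_, ?_⟩
    · rw [Finset.card_union_of_disjoint (Finset.disjoint_of_subset_right h4 hTγ), h1, h5]
    · rw [Finset.card_union_of_disjoint
        (Finset.disjoint_of_subset_right Finset.sdiff_subset hTγ), h1]
      omega
    · rw [← Finset.union_inter_distrib_left, Finset.inter_sdiff_self, Finset.union_empty, h1]
  · rintro ⟨α, β⟩ _
    simp only [Prod.mk.injEq]
    constructor
    · ext x
      simp only [Finset.mem_union, Finset.mem_sdiff, Finset.mem_inter]
      tauto
    · ext x
      simp only [Finset.mem_union, Finset.mem_sdiff, Finset.mem_inter]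
      tauto
  · rintro ⟨γ, T, σ⟩ hq
    simp only [Finset.mem_sigma, Finset.mem_powersetCard, Finset.subset_univ, true_and] at hq
    obtain ⟨_, ⟨h2, _⟩, h4, _⟩ := hq
    have hT : ∀ x ∈ T, x ∉ γ := fun x hx => Finset.mem_compl.mp (h2 hx)
    simp only [Sigma.mk.injEq, heq_eq_eq]
    refine ⟨?_, ?_, ?_⟩ <;>
    · ext x
      have := hT x
      have := @h4 x
      simp only [Finset.mem_union, Finset.mem_sdiff, Finset.mem_inter]
      tauto
  · rintro ⟨α, β⟩ _
    simp only
    congr 2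
    · ext x
      simp only [Finset.mem_union, Finset.mem_sdiff, Finset.mem_inter]
      tauto
    · ext x
      simp only [Finset.mem_union, Finset.mem_sdiff, Finset.mem_inter]
      tauto

theorem minorSum_one_pos {n k a b : ℕ} (h : k + a + b ≤ n) :
    0 < minorSum (k + a) (k + b) k (1 : Matrix (Fin n) (Fin n) ℝ) := by
  rw [minorSum_eq_sum]
  have hne : ∀ (j : ℕ) (s : Finset (Fin n)), j ≤ s.card → (Finset.powersetCard j s).Nonempty :=
    fun j s h => Finset.powersetCard_nonempty.mpr h
  refine Finset.sum_pos (fun γ hγ => ?_) (hne _ _ (by simp; omega))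
  rw [Finset.mem_powersetCard] at hγ
  refine Finset.sum_pos (fun T hT => ?_)
    (hne _ _ (by rw [Finset.card_compl, Fintype.card_fin]; omega))
  rw [Finset.mem_powersetCard] at hT
  refine Finset.sum_pos (fun σ _ => ?_) (hne _ _ (by omega))
  simp [principalMinor_one]

/-- Each group is counted by `(2q+2).choose (q+2)` or `(2q+2).choose (q+1)`. -/
theorem minorSum_one_eq {n : ℕ} (k q : ℕ) :
    ((q : ℝ) + 2) * minorSum (k + (q + 2)) (k + q) k (1 : Matrix (Fin n) (Fin n) ℝ)
      = (q + 1) * minorSum (k + (q + 1)) (k + (q + 1)) k (1 : Matrix (Fin n) (Fin n) ℝ) := by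
  rw [minorSum_eq_sum, minorSum_eq_sum]
  simp only [Finset.mul_sum (Finset.powersetCard k Finset.univ)]
  refine Finset.sum_congr rfl fun γ _ => ?_
  rw [show q + 2 + q = q + 1 + (q + 1) by omega]
  simp only [Finset.mul_sum (Finset.powersetCard _ γᶜ)]
  refine Finset.sum_congr rfl fun T hT => ?_
  rw [Finset.mem_powersetCard] at hT
  simp only [principalMinor_one, mul_one, Finset.sum_const, Finset.card_powersetCard, nsmul_eq_mul,
    hT.2]
  have h := Nat.choose_succ_right_eq (q + 1 + (q + 1)) (q + 1)
  rw [show q + 1 + (q + 1) - (q + 1) = q + 1 by omega, show q + 1 + 1 = q + 2 by omega] at h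
  have h' : ((q + 1 + (q + 1)).choose (q + 2) : ℝ) * (q + 2)
      = (q + 1 + (q + 1)).choose (q + 1) * (q + 1) := by exact_mod_cast h
  linarith

/-- The inequality for a fixed intersection `γ` and a fixed symmetric difference `T`. -/
theorem sum_principalMinor_mul_le {n q : ℕ} {A : Matrix (Fin n) (Fin n) ℝ}
    (hA : ∀ i j, i ≠ j → A i j ≤ 0) (hpos : ∀ α, 0 < principalMinor A α) {γ T : Finset (Fin n)}
    (hγT : Disjoint γ T) (hT : T.card = q + 1 + (q + 1)) :
    ((q : ℝ) + 2) * ∑ σ ∈ T.powersetCard (q + 2),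
        principalMinor A (γ ∪ σ) * principalMinor A (γ ∪ T \ σ)
      ≤ (q + 1) * ∑ σ ∈ T.powersetCard (q + 1),
        principalMinor A (γ ∪ σ) * principalMinor A (γ ∪ T \ σ) := by
  obtain ⟨x, hx, hAx⟩ := exists_isStrictDominant_mul_diagonal hA hpos
  obtain ⟨B, c, hB, hc, hBc⟩ := hAx.exists_schur γ
  -- The column scaling multiplies every term by the same `d`: indices of `γ` occur in both minors,
  -- those of `T` in exactly one.
  set d : ℝ := (∏ i ∈ γ, x i) ^ 2 * ∏ i ∈ T, x i with hd
  have hd0 : 0 < d := by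
    have h1 : 0 < ∏ i ∈ γ, x i := Finset.prod_pos fun i _ => hx i
    have h2 : 0 < ∏ i ∈ T, x i := Finset.prod_pos fun i _ => hx i
    positivity
  have hterm : ∀ σ ⊆ T, d * (principalMinor A (γ ∪ σ) * principalMinor A (γ ∪ T \ σ))
      = c ^ 2 * (principalMinor B σ * principalMinor B (T \ σ)) := by
    intro σ hσ
    have h1 := Finset.disjoint_of_subset_right hσ hγT
    have h2 := Finset.disjoint_of_subset_right (Finset.sdiff_subset (s := T) (t := σ)) hγT
    have e1 := hBc σ h1
    have e2 := hBc (T \ σ) h2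
    rw [principalMinor_mul_diagonal, Finset.prod_union h1] at e1
    rw [principalMinor_mul_diagonal, Finset.prod_union h2] at e2
    rw [hd, ← Finset.prod_sdiff hσ]
    calc _ = ((∏ i ∈ γ, x i) * (∏ i ∈ σ, x i) * principalMinor A (γ ∪ σ)) *
          ((∏ i ∈ γ, x i) * (∏ i ∈ T \ σ, x i) * principalMinor A (γ ∪ T \ σ)) := by ring
      _ = _ := by rw [e1, e2]; ring
  have hsum : ∀ j, d * ∑ σ ∈ T.powersetCard j,
      principalMinor A (γ ∪ σ) * principalMinor A (γ ∪ T \ σ)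
      = c ^ 2 * (minorPairPoly B T).coeff j := by
    intro j
    rw [coeff_minorPairPoly, Finset.mul_sum, Finset.mul_sum]
    exact Finset.sum_congr rfl fun σ hσ => hterm σ (Finset.mem_powersetCard.mp hσ).1
  have hU := hB.isBinomUnimodal_minorPairPoly T
  rw [hT] at hU
  -- `mono` compares coefficients `q` and `q + 1`; palindromicity replaces `q` by `q + 2`.
  have hs := hU.symm q (by omega)
  have hm := hU.mono q (by omega)
  rw [show q + 1 + (q + 1) - q = q + 2 by omega] at hs
  rw [← hs] at hm
  push_cast at hm
  refine le_of_mul_le_mul_left ?_ hd0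
  rw [mul_left_comm, hsum, mul_left_comm d, hsum]
  have := mul_le_mul_of_nonneg_left hm (sq_nonneg c)
  linarith

theorem minorSum_le_of_principalMinor_pos {n : ℕ} {A : Matrix (Fin n) (Fin n) ℝ}
    (hA : ∀ i j, i ≠ j → A i j ≤ 0) (hpos : ∀ α, 0 < principalMinor A α) (k q : ℕ) :
    ((q : ℝ) + 2) * minorSum (k + (q + 2)) (k + q) k A
      ≤ (q + 1) * minorSum (k + (q + 1)) (k + (q + 1)) k A := by
  rw [minorSum_eq_sum, minorSum_eq_sum]
  simp only [Finset.mul_sum (Finset.powersetCard k Finset.univ)]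
  refine Finset.sum_le_sum fun γ _ => ?_
  rw [show q + 2 + q = q + 1 + (q + 1) by omega]
  simp only [Finset.mul_sum (Finset.powersetCard _ γᶜ)]
  refine Finset.sum_le_sum fun T hT => ?_
  rw [Finset.mem_powersetCard] at hT
  exact sum_principalMinor_mul_le hA hpos (Finset.subset_compl_iff_disjoint_left.mp hT.1) hT.2

theorem continuous_minorSum {n : ℕ} (m₁ m₂ k : ℕ) :
    Continuous fun A : Matrix (Fin n) (Fin n) ℝ => minorSum m₁ m₂ k A :=
  continuous_finsetSum _ fun p _ =>
    (continuous_principalMinor p.1).mul (continuous_principalMinor p.2)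

theorem IsMMatrix.minorSum_le {n : ℕ} {A : Matrix (Fin n) (Fin n) ℝ} (hA : IsMMatrix A)
    (k q : ℕ) :
    ((q : ℝ) + 2) * minorSum (k + (q + 2)) (k + q) k A
      ≤ (q + 1) * minorSum (k + (q + 1)) (k + (q + 1)) k A := by
  have hcont : Continuous fun ε : ℝ => A + ε • (1 : Matrix (Fin n) (Fin n) ℝ) := by fun_prop
  have htend : ∀ m₁ m₂ : ℕ, ∀ c : ℝ, Filter.Tendsto
      (fun ε : ℝ => c * minorSum m₁ m₂ k (A + ε • (1 : Matrix (Fin n) (Fin n) ℝ)))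
      (nhdsWithin 0 (Set.Ioi 0)) (nhds (c * minorSum m₁ m₂ k A)) := by
    intro m₁ m₂ c
    have hc : Continuous fun ε : ℝ => c * minorSum m₁ m₂ k (A + ε • (1 : Matrix (Fin n) (Fin n) ℝ)) :=
      continuous_const.mul ((continuous_minorSum m₁ m₂ k).comp hcont)
    have h := hc.tendsto' (0 : ℝ) (c * minorSum m₁ m₂ k A) (by simp)
    exact h.mono_left nhdsWithin_le_nhds
  refine le_of_tendsto_of_tendsto (htend _ _ _) (htend _ _ _) ?_
  filter_upwards [self_mem_nhdsWithin] with ε hε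
  refine minorSum_le_of_principalMinor_pos (fun i j hij => ?_)
    (principalMinor_add_smul_one_pos hA.1 hε) k q
  simpa [Matrix.one_apply_ne hij] using hA.2 i j hij

/-! ### Inverse M-matrices and the conclusion -/

theorem minorSum_eq_minorSum_inv {n m₁ m₂ k : ℕ} {A : Matrix (Fin n) (Fin n) ℝ}
    (hA : IsUnit A.det) (h₁ : m₁ ≤ n) (h₂ : m₂ ≤ n) (h : m₁ + m₂ ≤ n + k) :
    minorSum m₁ m₂ k A = A.det ^ 2 * minorSum (n - m₂) (n - m₁) (n + k - m₁ - m₂) A⁻¹ := by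
  rw [minorSum, minorSum, Finset.mul_sum]
  have hcard : ∀ α β : Finset (Fin n),
      (βᶜ ∩ αᶜ).card + α.card + β.card = n + (α ∩ β).card := by
    intro α β
    have e1 := Finset.card_union_add_card_inter α β
    have e2 := Finset.card_add_card_compl (α ∪ β)
    rw [Fintype.card_fin] at e2
    rw [← Finset.compl_union, Finset.union_comm β α]
    omega
  have hle : ∀ α : Finset (Fin n), α.card ≤ n := fun α => by
    simpa using Finset.card_le_univ α
  -- Complementing also swaps the pair, so that the larger set stays first.
  refine Finset.sum_nbij' (fun p => (p.2ᶜ, p.1ᶜ)) (fun p => (p.2ᶜ, p.1ᶜ)) ?_ ?_ ?_ ?_ ?_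
  · rintro ⟨α, β⟩ hp
    simp only [Finset.mem_filter, Finset.mem_univ, true_and, Finset.card_compl,
      Fintype.card_fin] at hp ⊢
    have := hcard α β
    omega
  · rintro ⟨α, β⟩ hp
    simp only [Finset.mem_filter, Finset.mem_univ, true_and, Finset.card_compl,
      Fintype.card_fin] at hp ⊢
    have := hcard α β
    have := hle α
    have := hle β
    omega
  · simp
  · simp
  · rintro ⟨α, β⟩ _
    simp only
    rw [principalMinor_eq_det_mul_inv hA α, principalMinor_eq_det_mul_inv hA β]
    ring

theorem IsInverseMMatrix.minorSum_le {n : ℕ} {A : Matrix (Fin n) (Fin n) ℝ}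
    (hA : IsInverseMMatrix A) {k q : ℕ} (h : k + 2 * (q + 1) ≤ n) :
    ((q : ℝ) + 2) * minorSum (k + (q + 2)) (k + q) k A
      ≤ (q + 1) * minorSum (k + (q + 1)) (k + (q + 1)) k A := by
  obtain ⟨l, rfl⟩ := Nat.exists_eq_add_of_le h
  rw [minorSum_eq_minorSum_inv hA.1 (by omega) (by omega) (by omega),
    minorSum_eq_minorSum_inv hA.1 (by omega) (by omega) (by omega)]
  have h1 := hA.2.minorSum_le l q
  rw [show k + 2 * (q + 1) + l - (k + q) = l + (q + 2) by omega,
    show k + 2 * (q + 1) + l - (k + (q + 2)) = l + q by omega,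
    show k + 2 * (q + 1) + l - (k + (q + 1)) = l + (q + 1) by omega,
    show k + 2 * (q + 1) + l + k - (k + (q + 2)) - (k + q) = l by omega,
    show k + 2 * (q + 1) + l + k - (k + (q + 1)) - (k + (q + 1)) = l by omega,
    mul_left_comm, mul_left_comm ((q : ℝ) + 1)]
  exact mul_le_mul_of_nonneg_left h1 (sq_nonneg _)

theorem theorem1 (n m k : ℕ) (hm : m < n) (hk : k < m) (hmk : 2 * m ≤ n + k)
    (A : Matrix (Fin n) (Fin n) ℝ) (hA : IsMMatrix A ∨ IsInverseMMatrix A) :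
    0 < minorSum m m k (1 : Matrix (Fin n) (Fin n) ℝ) ∧
    0 < minorSum (m + 1) (m - 1) k (1 : Matrix (Fin n) (Fin n) ℝ) ∧
    minorSum m m k A / minorSum m m k (1 : Matrix (Fin n) (Fin n) ℝ) ≥
      minorSum (m + 1) (m - 1) k A /
        minorSum (m + 1) (m - 1) k (1 : Matrix (Fin n) (Fin n) ℝ) := by
  obtain ⟨q, rfl⟩ := Nat.exists_eq_add_of_lt hk
  rw [show k + q + 1 + 1 = k + (q + 2) by omega, show k + q + 1 - 1 = k + q by omega,
    show k + q + 1 = k + (q + 1) by omega]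
  have h1 : 0 < minorSum (k + (q + 1)) (k + (q + 1)) k (1 : Matrix (Fin n) (Fin n) ℝ) :=
    minorSum_one_pos (by omega)
  have h2 : 0 < minorSum (k + (q + 2)) (k + q) k (1 : Matrix (Fin n) (Fin n) ℝ) :=
    minorSum_one_pos (by omega)
  refine ⟨h1, h2, ?_⟩
  have h3 := minorSum_one_eq (n := n) k q
  have h4 : ((q : ℝ) + 2) * minorSum (k + (q + 2)) (k + q) k A
      ≤ (q + 1) * minorSum (k + (q + 1)) (k + (q + 1)) k A := by
    rcases hA with hA | hA
    · exact hA.minorSum_le k q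
    · exact hA.minorSum_le (by omega)
  -- Expanding the fractions by `q + 2` and `q + 1` gives them the same denominator, by `h3`.
  rw [ge_iff_le, ← mul_div_mul_left _ _ (show (q : ℝ) + 2 ≠ 0 by positivity), h3,
    ← mul_div_mul_left (minorSum (k + (q + 1)) (k + (q + 1)) k A) _
      (show (q : ℝ) + 1 ≠ 0 by positivity)]
  gcongr
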